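/- Let $D$ be a finite oriented graph (a digraph without loops, parallel arcs or directed cycles of length two) with at least one vertex. For a vertex $v$ let $N^+(v)$ be the set of its out-neighbors, let $N^{++}(v)$ be the set of vertices at distance exactly two from $v$, and put $d^+(v)=|N^+(v)|$, $d^{++}(v)=|N^{++}(v)|$. A missing edge of $D$ is a pair of distinct vertices with no arc between them. The missing graph $G$ of $D$ is the graph whose edges are the missing edges of $D$ and whose vertices are the vertices of $D$ incident to at least one missing edge. A graph $G$ is called a comb if there are integers $n\ge 0$, $l\ge 1$ and $1\le k_0\le l$ such that: 1. $V(G)$ is the disjoint union of sets $A_0,\dots,A_n$, $M_1,\dots,M_l$, $X_1,\dots,X_{n+1}$, $Y_2,\dots,Y_{l+2}$; put $Y_1=X_1$, $A=\bigcup_{i=0}^n A_i$, $M=\bigcup_{i=1}^l M_i$, $X=\bigcup_{i=1}^{n+1}X_i$, $Y=\bigcup_{i=1}^{l+2}Y_i$. 2. $A\cup M$ is a stable set and $X\cup Y$ is a clique. 3. Every vertex of $A_i$ is adjacent to every vertex of $X_j$ for all $1\le j\le i\le n$. 4. Every vertex of $A$ is adjacent to every vertex of $Y$. 5. For every $1\le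 i\le l$ with $M_i\neq\emptyset$, the edges between $M_i$ and $Y_i$ form a perfect matching of $G[M_i\cup Y_i]$ between $M_i$ and $Y_i$. 6. Every vertex of $M_i$ is adjacent to every vertex of $Y_j$ for all $1\le i<j\le l$. 7. Every vertex of $M_i$ is adjacent to every vertex of $Y_{l+1}$ for all $1\le i\le k_0$. 8. Among these sets only $X_{n+1}$, $Y_{l+2}$, $Y_{l+1}$, $M_l$ and $A_0$ may be empty (when $n=0$, the set $Y_1=X_1$ is $X_{n+1}$). 9. $G$ has no edges other than those inside the clique $X\cup Y$ and those described in 3--7. **Theorem.** If the missing graph of $D$ is a comb, then $D$ has a vertex $v$ with $d^+(v)\le d^{++}(v)$. -/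

import Mathlib

namespace Digraph

variable {V : Type*}

/-- An oriented graph: a digraph without directed cycles of length two (taking `x = y`, this also
excludes loops). -/
def IsOriented (D : Digraph V) : Prop :=
  ∀ x y, D.Adj x y → ¬ D.Adj y x

/-- The first out-neighborhood `N⁺(v)`. -/
def outNbrs (D : Digraph V) (v : V) : Set V :=
  {w | D.Adj v w}

/-- The second out-neighborhood `N⁺⁺(v)`: the vertices at distance exactly two from `v`. -/
def secondOutNbrs (D : Digraph V) (v : V) : Set V :=
  {w | w ≠ v ∧ ¬ D.Adj v w ∧ ∃ u, D.Adj v u ∧ D.Adj u w}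

/-- The second neighborhood property `d⁺(v) ≤ d⁺⁺(v)`. -/
def HasSNP (D : Digraph V) (v : V) : Prop :=
  (D.outNbrs v).ncard ≤ (D.secondOutNbrs v).ncard

/-- `xy` is a missing edge of `D`: two distinct vertices with no arc between them. -/
def IsMissingEdge (D : Digraph V) (x y : V) : Prop :=
  x ≠ y ∧ ¬ D.Adj x y ∧ ¬ D.Adj y x

/-- A vertex is whole if it is not incident to any missing edge. -/
def IsWhole (D : Digraph V) (v : V) : Prop :=
  ∀ w, ¬ D.IsMissingEdge v w

/-- The missing graph of `D`: its vertices are the non-whole vertices of `D`, its edges are the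
missing edges of `D`. -/
def missingGraph (D : Digraph V) : SimpleGraph {v : V // ¬ D.IsWhole v} where
  Adj x y := D.IsMissingEdge x y
  symm := ⟨fun _ _ h => ⟨h.1.symm, h.2.2, h.2.1⟩⟩
  loopless := ⟨fun _ h => h.1 rfl⟩

end Digraph

namespace SimpleGraph

variable {W : Type*}

/-- `G[S ∪ K]` is an `{S, K}`-split graph: `S` and `K` are disjoint, `S` is stable and `K` is a
clique. -/
def IsSplitOn (G : SimpleGraph W) (S K : Set W) : Prop :=
  Disjoint S K ∧ G.IsIndepSet S ∧ G.IsClique K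

/-- `G[S ∪ K]` is a complete split graph. -/
def IsCompleteSplitOn (G : SimpleGraph W) (S K : Set W) : Prop :=
  G.IsSplitOn S K ∧ ∀ s ∈ S, ∀ x ∈ K, G.Adj s x

/-- `G[S ∪ K]` is a perfect split graph: the edges between `S` and `K` form a perfect matching of
`G[S ∪ K]`. -/
def IsPerfectSplitOn (G : SimpleGraph W) (S K : Set W) : Prop :=
  G.IsSplitOn S K ∧ (∀ s ∈ S, ∃! x, x ∈ K ∧ G.Adj s x) ∧ (∀ x ∈ K, ∃! s, s ∈ S ∧ G.Adj s x)

/-- Names for the sets into which the vertex set of a comb is partitioned. -/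
inductive CombIndex where
  | A (i : ℕ)
  | M (i : ℕ)
  | X (i : ℕ)
  | Y (i : ℕ)

/-- The names in use: `A₀, …, Aₙ`, `M₁, …, Mₗ`, `X₁, …, Xₙ₊₁` and `Y₂, …, Yₗ₊₂`. The set `Y₁ = X₁`
is not listed a second time. -/
def CombIndex.InRange (n l : ℕ) : CombIndex → Prop
  | .A i => i ≤ n
  | .M i => 1 ≤ i ∧ i ≤ l
  | .X i => 1 ≤ i ∧ i ≤ n + 1
  | .Y i => 2 ≤ i ∧ i ≤ l + 2

/-- The set with a given name. -/
def CombIndex.toSet (A M X Y : ℕ → Set W) : CombIndex → Set W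
  | .A i => A i
  | .M i => M i
  | .X i => X i
  | .Y i => Y i

/-- The sets `A₀, …, Aₙ`, `M₁, …, Mₗ`, `X₁, …, Xₙ₊₁`, `Y₁ = X₁, Y₂, …, Yₗ₊₂` and the number `k₀`
exhibit `G` as a comb. Values of `A`, `M`, `X`, `Y` outside these ranges play no role. -/
structure IsCombWith (G : SimpleGraph W) (n l k₀ : ℕ) (A M X Y : ℕ → Set W) : Prop where
  k₀_pos : 1 ≤ k₀
  k₀_le : k₀ ≤ l
  Y_one : Y 1 = X 1
  /-- The vertex set is the disjoint union of the sets of the comb. -/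
  partition : ∀ v, ∃! c : CombIndex, c.InRange n l ∧ v ∈ c.toSet A M X Y
  /-- `S = A ∪ M` is stable. -/
  stable : G.IsIndepSet ((⋃ i ∈ Set.Icc 0 n, A i) ∪ ⋃ i ∈ Set.Icc 1 l, M i)
  /-- `K = X ∪ Y` is a clique. -/
  clique : G.IsClique ((⋃ i ∈ Set.Icc 1 (n + 1), X i) ∪ ⋃ i ∈ Set.Icc 1 (l + 2), Y i)
  complete_A_X : ∀ i j, 1 ≤ j → j ≤ i → i ≤ n → G.IsCompleteSplitOn (A i) (X j)
  complete_A_Y : G.IsCompleteSplitOn (⋃ i ∈ Set.Icc 0 n, A i) (⋃ i ∈ Set.Icc 1 (l + 2), Y i)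
  /-- Only `Mₗ` may be empty, and then there is no matching to ask for. -/
  perfect_M_Y : ∀ i, 1 ≤ i → i ≤ l → (M i).Nonempty → G.IsPerfectSplitOn (M i) (Y i)
  complete_M_Y : ∀ i j, 1 ≤ i → i < j → j ≤ l → G.IsCompleteSplitOn (M i) (Y j)
  complete_M_Y_last : ∀ i, 1 ≤ i → i ≤ k₀ → G.IsCompleteSplitOn (M i) (Y (l + 1))
  /-- `Xₙ₊₁`, `Yₗ₊₂`, `Yₗ₊₁`, `Mₗ` and `A₀` are the only possibly empty sets. (If `n = 0` then
  `Y₁ = X₁` is `Xₙ₊₁`.) -/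
  A_nonempty : ∀ i, 1 ≤ i → i ≤ n → (A i).Nonempty
  X_nonempty : ∀ i, 1 ≤ i → i ≤ n → (X i).Nonempty
  M_nonempty : ∀ i, 1 ≤ i → i < l → (M i).Nonempty
  Y_nonempty : ∀ i, 2 ≤ i → i ≤ l → (Y i).Nonempty
  /-- There are no edges other than those inside `K` and those described above. -/
  only_edges : ∀ u v, G.Adj u v →
    u ∈ (⋃ i ∈ Set.Icc 0 n, A i) ∪ ⋃ i ∈ Set.Icc 1 l, M i →
    v ∈ (⋃ i ∈ Set.Icc 1 (n + 1), X i) ∪ ⋃ i ∈ Set.Icc 1 (l + 2), Y i →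
      (∃ i j, 1 ≤ j ∧ j ≤ i ∧ i ≤ n ∧ u ∈ A i ∧ v ∈ X j) ∨
      (∃ i j, i ≤ n ∧ 1 ≤ j ∧ j ≤ l + 2 ∧ u ∈ A i ∧ v ∈ Y j) ∨
      (∃ i, 1 ≤ i ∧ i ≤ l ∧ u ∈ M i ∧ v ∈ Y i) ∨
      (∃ i j, 1 ≤ i ∧ i < j ∧ j ≤ l ∧ u ∈ M i ∧ v ∈ Y j) ∨
      (∃ i, 1 ≤ i ∧ i ≤ k₀ ∧ u ∈ M i ∧ v ∈ Y (l + 1))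

/-- `G` is a comb. -/
def IsComb (G : SimpleGraph W) : Prop :=
  ∃ (n l k₀ : ℕ) (A M X Y : ℕ → Set W), G.IsCombWith n l k₀ A M X Y

end SimpleGraph

/-!
Call a missing edge `ab` good if `(a, b)` or `(b, a)` is convenient, where `(a, b)` is convenient
if every in-neighbor of `a` reaches `b` in at most two steps. If all missing edges are good, add a
convenient orientation of each of them to obtain a tournament and take a median order of it. The
argument of Havet and Thomassé, applied to the last vertex `f` of this order, shows that
`d⁺(f) ≤ d⁺⁺(f)` in the original digraph (`Digraph.exists_hasSNP_of_convenient`): along the order,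
each vertex that `f` does not reach in two steps dominates, in the tournament, all out-neighbors
of `f`, while among the vertices of a segment preceding it, it dominates at most half.

A missing edge `cd` that is not good is beaten by some missing edge `ab`: there are arcs `a → c`
and `b → d`, but `a` does not reach `d`, nor `b` reach `c`, in two steps (`Digraph.Loses`). Then
`a b d c` is an alternating four-cycle of the missing graph. A comb is a split graph in which the
neighborhoods of the vertices of the stable part are nested, except along the perfect matchings
between `M_i` and `Y_i`. Hence the relation lives on these matchings, every edge beats and is
beaten by at most one other, and there are no cycles, since the out-degree inside the stable part
of the end lying there increases (`Digraph.Loses.ssubset_outNbrs`). So the missing edges form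
chains. The first edge of a chain is good; orient it conveniently and pass the orientation on along
the chain (`Digraph.Oriented`). Add these arcs to `D`, except for the last edge of every chain.

All missing edges of the resulting digraph are good (`Digraph.not_loses_extend`), so it has a
vertex `f` with the second neighborhood property. If `f` has no new out-neighbor, then its second
out-neighborhood did not grow either. Otherwise it has exactly one, say `b`, and if `fb` loses to
`cd`, then `d` is the only vertex that `f` reaches in the new digraph without reaching it in `D`.
The loss of one out-neighbor therefore makes up for that of at most one second out-neighbor
(`Digraph.HasSNP.of_extend`).
-/

namespace Digraph

variable {V : Type*}

/-! ### Median orders -/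

open Classical in
/-- The number of pairs of entries of a list, taken in the order of the list, that are related
by `T`. For a list of the vertices of a tournament `T` these are the forward arcs. -/
noncomputable def forwardArcs (T : V → V → Prop) : List V → ℕ
  | [] => 0
  | x :: l => l.countP (T x) + forwardArcs T l

open Classical in
theorem forwardArcs_move_front (T : V → V → Prop) (b : V) (m l : List V) :
    forwardArcs T (m ++ b :: l) + m.countP (T b) =
      forwardArcs T (b :: (m ++ l)) + m.countP (T · b) := by
  induction m with
  | nil => simp
  | cons x m ih =>
    simp only [List.cons_append, forwardArcs, List.countP_append, List.countP_cons] at ih ⊢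
    omega

theorem forwardArcs_append_left (T : V → V → Prop) (l : List V) {m m' : List V}
    (hp : m.Perm m') (h : forwardArcs T m < forwardArcs T m') :
    forwardArcs T (l ++ m) < forwardArcs T (l ++ m') := by
  induction l with
  | nil => simpa using h
  | cons x l ih =>
    simp only [List.cons_append, forwardArcs]
    rw [(hp.append_left l).countP_eq]
    omega

open Classical in
/-- Existence of median orders, with the feedback property: in a segment preceding `b`, at most
half of the vertices related to `b` are dominated by `b`. -/
theorem exists_medianOrder [Finite V] (T : V → V → Prop) :
    ∃ L : List V, (∀ v, v ∈ L) ∧ L.Nodup ∧ ∀ l m b r, L = l ++ (m ++ b :: r) →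
      m.countP (T b) ≤ m.countP (T · b) := by
  have := Fintype.ofFinite V
  obtain ⟨L, hL, hmax⟩ := Finset.exists_max_image
    (Finset.univ.toList : List V).permutations.toFinset (forwardArcs T)
    ⟨Finset.univ.toList, by simp [List.mem_permutations]⟩
  simp only [List.mem_toFinset, List.mem_permutations] at hL hmax
  refine ⟨L, fun v => hL.mem_iff.2 (by simp), hL.nodup_iff.2 (Finset.nodup_toList _), ?_⟩
  rintro l m b r rfl
  by_contra! hlt
  have hmove := forwardArcs_move_front T b m r
  have hp : (m ++ b :: r).Perm (b :: (m ++ r)) := List.perm_middle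
  have := hmax _ ((hp.symm.append_left l).trans hL)
  have := forwardArcs_append_left T l hp (by omega)
  omega

/-! ### Convenient orientations of missing edges -/

/-- `z` is an out-neighbor or a second out-neighbor of `x` (for `z ≠ x`). -/
def Reach (D : Digraph V) (x z : V) : Prop :=
  D.Adj x z ∨ ∃ u, D.Adj x u ∧ D.Adj u z

/-- `(a, b)` is a convenient orientation of the missing edge `ab`: adding the arc from `a` to `b`
puts `b` into no second out-neighborhood but that of vertices which reach `b` anyway. -/
def Convenient (D : Digraph V) (a b : V) : Prop :=
  ∀ w, D.Adj w a → D.Reach w b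

variable {D : Digraph V}

theorem IsMissingEdge.symm {a b : V} (h : D.IsMissingEdge a b) : D.IsMissingEdge b a :=
  ⟨h.1.symm, h.2.2, h.2.1⟩

theorem IsOriented.irrefl (hD : D.IsOriented) (a : V) : ¬ D.Adj a a := fun h => hD a a h h

theorem adj_or_adj_of_not_isMissingEdge {a b : V} (hne : a ≠ b) (h : ¬ D.IsMissingEdge a b) :
    D.Adj a b ∨ D.Adj b a := by
  unfold IsMissingEdge at h
  tauto

theorem mem_secondOutNbrs_of_reach {v w : V} (hD : D.IsOriented) (h : D.Reach v w)
    (hn : ¬ D.Adj v w) : w ∈ D.secondOutNbrs v := by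
  obtain h | ⟨u, hu, huw⟩ := h
  · exact absurd h hn
  · refine ⟨?_, hn, u, hu, huw⟩
    rintro rfl
    exact hD _ _ hu huw

/-- A tournament obtained from `D` by giving each missing edge a convenient orientation. -/
theorem exists_convenient_tournament (hD : D.IsOriented)
    (hgood : ∀ a b, D.IsMissingEdge a b → D.Convenient a b ∨ D.Convenient b a) :
    ∃ T : V → V → Prop, (∀ a b, T a b → ¬ T b a) ∧ (∀ a b, a ≠ b → ¬ T a b → T b a) ∧
      ∀ a b, T a b → D.Adj a b ∨ D.Convenient a b := by
  -- When both orientations are convenient, an arbitrary linear order decides.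
  refine ⟨fun a b => D.Adj a b ∨ (D.IsMissingEdge a b ∧ D.Convenient a b ∧
    (D.Convenient b a → WellOrderingRel a b)), ?_, ?_, ?_⟩
  · rintro a b (h | ⟨h, h1, h2⟩) (h' | ⟨h', h1', h2'⟩)
    · exact hD _ _ h h'
    · exact h'.2.2 h
    · exact h.2.2 h'
    · exact asymm (h2 h1') (h2' h1)
  · intro a b hne h
    simp only [not_or, not_and, Classical.not_imp] at h ⊢
    by_cases hba : D.Adj b a
    · exact Or.inl hba
    have hm : D.IsMissingEdge a b := ⟨hne, h.1, hba⟩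
    have h3 := trichotomous_of WellOrderingRel a b
    by_cases hab : D.Convenient a b
    · obtain ⟨h4, h5⟩ := h.2 hm hab
      exact Or.inr ⟨hm.symm, h4, fun _ => (h3.resolve_left h5).resolve_left hne⟩
    · exact Or.inr ⟨hm.symm, (hgood a b hm).resolve_left hab, fun h => absurd h hab⟩
  · rintro a b (h | ⟨-, h, -⟩)
    · exact Or.inl h
    · exact Or.inr h

/-- If every missing edge has a convenient orientation, then the last vertex of a median order of
the tournament obtained by adding convenient orientations has the second neighborhood property. -/
theorem exists_hasSNP_of_convenient [Finite V] [Nonempty V] (hD : D.IsOriented)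
    (hgood : ∀ a b, D.IsMissingEdge a b → D.Convenient a b ∨ D.Convenient b a) :
    ∃ v, D.HasSNP v := by
  classical
  obtain ⟨T, hTasymm, hTtotal, hT⟩ := exists_convenient_tournament hD hgood
  obtain ⟨L, hmem, hnd, hL⟩ := exists_medianOrder T
  obtain rfl | ⟨L, f, rfl⟩ := L.eq_nil_or_concat'
  · exact absurd (hmem (Classical.arbitrary V)) (by simp)
  refine ⟨f, ?_⟩
  let P : V → Prop := fun x => D.Adj f x
  let Q : V → Prop := fun x => x ∈ D.secondOutNbrs f
  have hPQ : ∀ x, P x → ¬ Q x := fun x hx hq => hq.2.1 hx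
  -- Every vertex outside both neighborhoods dominates, in `T`, all out-neighbors of `f`.
  have hout : ∀ b, ¬ P b → ¬ Q b → ∀ p, P p → T b p := by
    intro b hb hq p hp
    by_contra hbp
    apply hq
    apply mem_secondOutNbrs_of_reach hD _ hb
    obtain h | h := hT _ _ (hTtotal b p (fun h => hb (h ▸ hp)) hbp)
    · exact Or.inr ⟨p, hp, h⟩
    · exact h f hp
  have key : ∀ k (r l : List V), r.length ≤ k → L ++ [f] = l ++ r →
      r.countP P ≤ r.countP Q := by
    intro k
    induction k with
    | zero =>
      intro r l hr _
      rw [List.length_eq_zero_iff.1 (Nat.le_zero.1 hr)]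
      simp
    | succ k ih =>
      intro r l hr h
      -- Split the suffix at its first vertex outside both neighborhoods.
      by_cases hex : ∃ b ∈ r, ¬ P b ∧ ¬ Q b
      · obtain ⟨m, b, r', hrfl, hm, hb⟩ : ∃ m b r', r = m ++ b :: r' ∧
            (∀ x ∈ m, P x ∨ Q x) ∧ ¬ P b ∧ ¬ Q b := by
          clear hr h
          induction r with
          | nil => simp at hex
          | cons x r ihr =>
            by_cases hx : ¬ P x ∧ ¬ Q x
            · exact ⟨[], x, r, by simp, by simp, hx⟩
            · obtain ⟨m, b, r', rfl, hm, hb⟩ := ihr (by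
                obtain ⟨b, hb, hb'⟩ := hex
                rcases List.mem_cons.1 hb with rfl | hb
                · exact absurd hb' hx
                · exact ⟨b, hb, hb'⟩)
              refine ⟨x :: m, b, r', by simp, ?_, hb⟩
              intro y hy
              rcases List.mem_cons.1 hy with rfl | hy
              · tauto
              · exact hm y hy
        subst hrfl
        have h1 : m.countP P ≤ m.countP (T b) :=
          List.countP_mono_left fun x _ hx => by
            simpa using hout b hb.1 hb.2 x (by simpa using hx)
        have h2 := hL l m b r' h
        have h3 : m.countP (T · b) ≤ m.countP Q :=
          List.countP_mono_left fun x hxm hx => by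
            have hx : T x b := by simpa using hx
            have : ¬ P x := fun hp => hTasymm _ _ hx (hout b hb.1 hb.2 x hp)
            simpa [this] using hm x hxm
        have h4 := ih r' (l ++ m ++ [b]) (by simp at hr; omega) (by simp [h])
        simp only [List.countP_append, List.countP_cons, hb.1, hb.2, decide_false]
        simp
        omega
      · -- The last vertex `f` lies in neither neighborhood, so only the empty suffix remains.
        obtain rfl | ⟨r, g, rfl⟩ := r.eq_nil_or_concat'
        · simp
        · exfalso
          rw [← List.append_assoc] at h
          have : f = g := by simpa using (List.append_inj' h rfl).2
          subst this
          exact hex ⟨f, by simp, hD.irrefl f, fun h => h.1 rfl⟩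
  have h := key _ _ [] le_rfl (List.nil_append _).symm
  have hcount : ∀ R : V → Prop, (L ++ [f]).countP R = {x | R x}.ncard := by
    intro R
    rw [List.countP_eq_length_filter, ← List.toFinset_card_of_nodup (hnd.filter _),
      ← Set.ncard_coe_finset]
    congr 1
    ext x
    have := hmem x
    simp only [Finset.mem_coe, List.mem_toFinset, List.mem_filter, decide_eq_true_eq,
      Set.mem_ofPred_eq]
    tauto
  rw [hcount, hcount] at h
  exact h

/-! ### Losing missing edges -/

/-- The missing edge `ab` loses to the missing edge `cd`, with `a` and `c`, respectively `b` and
`d`, corresponding to each other. These are the arcs of the dependency digraph of `D`. -/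
def Loses (D : Digraph V) (a b c d : V) : Prop :=
  D.IsMissingEdge a b ∧ D.IsMissingEdge c d ∧ D.Adj a c ∧ D.Adj b d ∧
    ¬ D.Reach a d ∧ ¬ D.Reach b c

theorem Loses.swap {a b c d : V} (h : D.Loses a b c d) : D.Loses b a d c :=
  ⟨h.1.symm, h.2.1.symm, h.2.2.2.1, h.2.2.1, h.2.2.2.2.2, h.2.2.2.2.1⟩

/-- A missing edge without a convenient orientation is beaten by another missing edge. -/
theorem exists_loses_of_not_convenient {a b : V} (hm : D.IsMissingEdge a b)
    (h1 : ¬ D.Convenient a b) (h2 : ¬ D.Convenient b a) : ∃ w w', D.Loses w w' a b := by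
  simp only [Convenient, not_forall] at h1 h2
  obtain ⟨w, hwa, hwb⟩ := h1
  obtain ⟨w', hwb', hwa'⟩ := h2
  refine ⟨w, w', ⟨?_, ?_, ?_⟩, hm, hwa, hwb', hwb, hwa'⟩
  · rintro rfl
    exact hwa' (Or.inl hwa)
  · exact fun h => hwb (Or.inr ⟨_, h, hwb'⟩)
  · exact fun h => hwa' (Or.inr ⟨_, h, hwa⟩)

/-! ### Comb-like missing graphs -/

/-- The features of a comb used in the proof, for the relation `r` of being joined by a missing
edge. The vertices of `S` span no missing edge, and
`Mt` is a matching formed by missing edges between `S` and its complement. Alternating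
four-cycles `a b d c`, in which `ab` and `cd` are missing edges while `ac` and `bd` are not, occur
only along two edges of the matching, whose ends are then twins but for the matching. -/
structure IsCombLike (r : V → V → Prop) (S : Set V) (Mt : V → V → Prop) : Prop where
  stable : ∀ a ∈ S, ∀ b ∈ S, ¬ r a b
  matched_symm : ∀ {a b}, Mt a b → Mt b a
  matched_unique : ∀ {a b b'}, Mt a b → Mt a b' → b = b'
  mem_iff_of_matched : ∀ {a b}, Mt a b → (a ∈ S ↔ b ∉ S)
  matched_of_alternating : ∀ {a b c d}, r a b → r c d → a ≠ c →
    ¬ r a c → b ≠ d → ¬ r b d → Mt a b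
  mem_iff_of_alternating : ∀ {a b c d}, r a b → r c d → a ≠ c →
    ¬ r a c → b ≠ d → ¬ r b d → (a ∈ S ↔ d ∈ S)
  eq_of_alternating : ∀ {a b c d f}, r a b → r c d → a ≠ c →
    ¬ r a c → b ≠ d → ¬ r b d → r f b → f ≠ c →
    ¬ r f c → f = a
  /-- Turning matching edges into arcs creates no alternating four-cycle: if `wa` is a matching
  edge and `ww'`, `ab` are missing edges, then `w'b` is a missing edge outside the matching,
  unless `w' = b`. -/
  of_matched : ∀ {w a w' b}, Mt w a → r w w' → r a b → w' ≠ a →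
    b ≠ w → (w' = b ∨ r w' b) ∧ ¬ Mt w' b

section

variable {S : Set V} {Mt : V → V → Prop} (hD : D.IsOriented) (hC : IsCombLike D.IsMissingEdge S Mt)
  {a b c d f v : V}

theorem Loses.alternating (hD : D.IsOriented) (h : D.Loses a b c d) :
    a ≠ c ∧ ¬ D.IsMissingEdge a c ∧ b ≠ d ∧ ¬ D.IsMissingEdge b d :=
  ⟨fun e => hD.irrefl a (e ▸ h.2.2.1), fun e => e.2.1 h.2.2.1,
    fun e => hD.irrefl b (e ▸ h.2.2.2.1), fun e => e.2.1 h.2.2.2.1⟩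

include hD hC

theorem Loses.matched_left (h : D.Loses a b c d) : Mt a b := by
  obtain ⟨h1, h2, h3, h4⟩ := h.alternating hD
  exact hC.matched_of_alternating h.1 h.2.1 h1 h2 h3 h4

theorem Loses.matched_right (h : D.Loses a b c d) : Mt c d := by
  obtain ⟨h1, h2, h3, h4⟩ := h.alternating hD
  exact hC.matched_of_alternating h.2.1 h.1 h1.symm (fun e => h2 e.symm) h3.symm
    (fun e => h4 e.symm)

/-- Among the vertices dominating `c`, only `a` fails to reach `d`. -/
theorem Loses.eq_of_adj_left (h : D.Loses a b c d) (hf : D.Adj f c) (hr : ¬ D.Reach f d) :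
    f = a := by
  obtain ⟨h1, h2, h3, h4⟩ := h.alternating hD
  refine hC.eq_of_alternating h.1 h.2.1 h1 h2 h3 h4 ⟨?_, ?_, ?_⟩ ?_ ?_
  · rintro rfl
    exact h.2.2.2.2.2 (Or.inl hf)
  · exact fun e => hr (Or.inr ⟨_, e, h.2.2.2.1⟩)
  · exact fun e => h.2.2.2.2.2 (Or.inr ⟨_, e, hf⟩)
  · exact fun e => hD.irrefl f (e ▸ hf)
  · exact fun e => e.2.1 hf

/-- Among the vertices dominated by `b`, only `d` is not reached from `a`. -/
theorem Loses.eq_of_adj_right (h : D.Loses a b c d) (hv : D.Adj b v) (hr : ¬ D.Reach a v) :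
    v = d := by
  obtain ⟨h1, h2, h3, h4⟩ := h.alternating hD
  refine hC.eq_of_alternating (a := d) (b := c) (c := b) (d := a) h.2.1.symm h.1.symm h3.symm
    (fun e => h4 e.symm) h1.symm (fun e => h2 e.symm) ⟨?_, ?_, ?_⟩ ?_ ?_
  · rintro rfl
    exact hr (Or.inl h.2.2.1)
  · exact fun e => h.2.2.2.2.2 (Or.inr ⟨_, hv, e⟩)
  · exact fun e => hr (Or.inr ⟨_, h.2.2.1, e⟩)
  · exact fun e => hD.irrefl b (e ▸ hv)
  · exact fun e => e.2.2 hv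

theorem Loses.pred_unique {a' b' : V} (h : D.Loses a b c d) (h' : D.Loses a' b' c d) :
    a' = a ∧ b' = b :=
  ⟨h.eq_of_adj_left hD hC h'.2.2.1 h'.2.2.2.2.1,
    h.swap.eq_of_adj_left hD hC h'.2.2.2.1 h'.2.2.2.2.2⟩

theorem Loses.succ_unique {c' d' : V} (h : D.Loses a b c d) (h' : D.Loses a b c' d') :
    d' = d :=
  h.eq_of_adj_right hD hC h'.2.2.2.1 h'.2.2.2.2.1

/-- Along the dependency digraph, the out-neighborhood inside `S` of the end in `S` grows: the
winning end dominates the losing one and everything which that one dominates. -/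
theorem Loses.ssubset_outNbrs (h : D.Loses a b c d) (ha : a ∈ S) :
    D.outNbrs a ∩ S ⊂ D.outNbrs d ∩ S := by
  obtain ⟨h1, h2, h3, h4⟩ := h.alternating hD
  have hd : d ∈ S := (hC.mem_iff_of_alternating h.1 h.2.1 h1 h2 h3 h4).1 ha
  obtain ⟨-, hcd, hac, -, had, -⟩ := h
  have key : ∀ x ∈ S, x ≠ d → ¬ D.Adj x d → D.Adj d x := fun x hx hne hn =>
    (adj_or_adj_of_not_isMissingEdge hne (hC.stable x hx d hd)).resolve_left hn
  rw [Set.ssubset_iff_of_subset]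
  · refine ⟨a, ⟨key a ha ?_ fun e => had (Or.inl e), ha⟩, fun e => hD.irrefl a e.1⟩
    rintro rfl
    exact hcd.2.2 hac
  · rintro x ⟨hx, hxS⟩
    refine ⟨key x hxS ?_ fun e => had (Or.inr ⟨_, hx, e⟩), hxS⟩
    rintro rfl
    exact had (Or.inl hx)

end

/-! ### Orienting the chains of the dependency digraph -/

/-- An orientation of the missing edges: an edge beaten by no other one receives a convenient
orientation, and orientations are passed on along the dependency digraph. -/
inductive Oriented (D : Digraph V) : V → V → Prop
  | root {a b : V} (hm : D.IsMissingEdge a b) (hab : D.Convenient a b)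
      (hba : D.Convenient b a → WellOrderingRel a b) (hroot : ∀ c d, ¬ D.Loses c d a b) :
      Oriented D a b
  | step {a b c d : V} (h : D.Loses a b c d) (hab : Oriented D a b) : Oriented D c d

/-- The missing edge `ab`, oriented from `a` to `b`, is turned into an arc when it loses to some
missing edge; the last edge of each chain of the dependency digraph stays missing. -/
def NewArc (D : Digraph V) (a b : V) : Prop :=
  D.Oriented a b ∧ ∃ c d, D.Loses a b c d

/-- The digraph obtained by adding the new arcs. -/
def extend (D : Digraph V) : Digraph V where
  Adj a b := D.Adj a b ∨ D.NewArc a b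

theorem NewArc.isMissingEdge {a b : V} (h : D.NewArc a b) : D.IsMissingEdge a b := by
  obtain ⟨-, c, d, h⟩ := h
  exact h.1

theorem Reach.extend {a b : V} (h : D.Reach a b) : D.extend.Reach a b := by
  obtain h | ⟨u, h1, h2⟩ := h
  · exact Or.inl (Or.inl h)
  · exact Or.inr ⟨u, Or.inl h1, Or.inl h2⟩

theorem IsMissingEdge.of_extend {a b : V} (h : D.extend.IsMissingEdge a b) :
    D.IsMissingEdge a b :=
  ⟨h.1, fun e => h.2.1 (Or.inl e), fun e => h.2.2 (Or.inl e)⟩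

section

variable {S : Set V} {Mt : V → V → Prop} (hD : D.IsOriented) (hC : IsCombLike D.IsMissingEdge S Mt)
  {a b c d f u v : V}

include hD hC

theorem Oriented.asymm (h : D.Oriented a b) : ¬ D.Oriented b a := by
  induction h with
  | root hm hab hba hroot =>
    intro h'
    cases h' with
    | root _ hba' hab' _ => exact _root_.asymm (hba hba') (hab' hab)
    | step h' _ => exact hroot _ _ h'.swap
  | step h _ ih =>
    intro h'
    cases h' with
    | root _ _ _ hroot => exact hroot _ _ h.swap
    | step h' ho =>
      obtain ⟨rfl, rfl⟩ := h.pred_unique hD hC h'.swap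
      exact ih ho

theorem oriented_or_oriented [Finite V] (hm : D.IsMissingEdge a b) :
    D.Oriented a b ∨ D.Oriented b a := by
  have hroot : ∀ {a b}, D.IsMissingEdge a b → (∀ c d, ¬ D.Loses c d a b) →
      D.Oriented a b ∨ D.Oriented b a := by
    intro a b hm hr
    have h3 := trichotomous_of WellOrderingRel a b
    by_cases h1 : D.Convenient a b
    · by_cases h2 : WellOrderingRel a b ∨ ¬ D.Convenient b a
      · exact Or.inl (.root hm h1 (fun h => h2.resolve_right (not_not.2 h)) hr)
      · rw [not_or, not_not] at h2
        exact Or.inr (.root hm.symm h2.2 (fun _ => (h3.resolve_left h2.1).resolve_left hm.1)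
          fun c d h => hr _ _ h.swap)
    · by_cases h2 : D.Convenient b a
      · exact Or.inr (.root hm.symm h2 (fun h => absurd h h1) fun c d h => hr _ _ h.swap)
      · obtain ⟨w, w', h⟩ := exists_loses_of_not_convenient hm h1 h2
        exact absurd h (hr w w')
  have key : ∀ n a b, (D.outNbrs a ∩ S).ncard = n → a ∈ S → D.IsMissingEdge a b →
      D.Oriented a b ∨ D.Oriented b a := by
    intro n
    induction n using Nat.strong_induction_on with
    | _ n ih =>
      intro a b hn ha hm
      by_cases hr : ∀ c d, ¬ D.Loses c d a b
      · exact hroot hm hr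
      push Not at hr
      obtain ⟨c, d, h⟩ := hr
      have hd : d ∈ S := by
        obtain ⟨h1, h2, h3, h4⟩ := h.alternating hD
        exact (hC.mem_iff_of_alternating h.2.1 h.1 h1.symm (fun e => h2 e.symm) h3.symm
          (fun e => h4 e.symm)).1 ha
      have hlt := Set.ncard_lt_ncard (h.swap.ssubset_outNbrs hD hC hd) (Set.toFinite _)
      obtain ho | ho := ih _ (hn ▸ hlt) d c rfl hd h.1.symm
      · exact Or.inr (.step h.swap ho)
      · exact Or.inl (.step h ho)
  by_cases hr : ∀ c d, ¬ D.Loses c d a b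
  · exact hroot hm hr
  push Not at hr
  obtain ⟨c, d, h⟩ := hr
  by_cases ha : a ∈ S
  · exact key _ a b rfl ha hm
  · have hb := (hC.mem_iff_of_matched (hC.matched_symm (h.matched_right hD hC))).2 ha
    exact (key _ b a rfl hb hm.symm).symm

theorem NewArc.matched (h : D.NewArc a b) : Mt a b := by
  obtain ⟨-, c, d, h⟩ := h
  exact h.matched_left hD hC

theorem IsOriented.extend : D.extend.IsOriented := by
  rintro a b (h | h) (h' | h')
  · exact hD _ _ h h'
  · exact h'.isMissingEdge.2.2 h
  · exact h.isMissingEdge.2.2 h'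
  · exact h.1.asymm hD hC h'.1

/-- No missing edge of the extension is beaten, so each of them has a convenient orientation: a
losing pair that uses arcs of `D` only would lose in `D` too, and would have become an arc. -/
theorem not_loses_extend [Finite V] {w w' : V} : ¬ D.extend.Loses w w' a b := by
  intro h
  obtain ⟨hw, hab, hwa, hwb, h1, h2⟩ := h
  have hw0 := hw.of_extend
  have hab0 := hab.of_extend
  -- A new arc between two missing edges excludes a second arc between them.
  have key : ∀ {w w' a b}, D.extend.IsMissingEdge w w' → D.extend.IsMissingEdge a b →
      D.NewArc w a → D.extend.Adj w' b → False := by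
    intro w w' a b hw hab hn hwb
    obtain ⟨h3, h4⟩ := hC.of_matched (hn.matched hD hC) hw.of_extend hab.of_extend
      (fun e => hw.2.1 (e ▸ Or.inr hn)) (fun e => hab.2.2 (e ▸ Or.inr hn))
    obtain hwb | hwb := hwb
    · obtain rfl | h3 := h3
      · exact hD.irrefl _ hwb
      · exact h3.2.1 hwb
    · exact h4 (hwb.matched hD hC)
  obtain hwa0 | hwa0 := hwa
  · obtain hwb0 | hwb0 := hwb
    · have hl : D.Loses w w' a b :=
        ⟨hw0, hab0, hwa0, hwb0, fun e => h1 e.extend, fun e => h2 e.extend⟩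
      obtain ho | ho := oriented_or_oriented hD hC hw0
      · exact hw.2.1 (Or.inr ⟨ho, _, _, hl⟩)
      · exact hw.2.2 (Or.inr ⟨ho, _, _, hl.swap⟩)
    · exact key hw.symm hab.symm hwb0 (Or.inl hwa0)
  · exact key hw hab hwa0 hwb

/-- An orientation that is not convenient was passed on from a missing edge losing to it, and only
the tail of this edge witnesses the inconvenience. -/
theorem Oriented.exists_newArc (h : D.Oriented u v) (hf : D.Adj f u) (hr : ¬ D.Reach f v) :
    ∃ b, D.NewArc f b ∧ D.Loses f b u v := by
  cases h with
  | root _ huv _ _ => exact absurd (huv f hf) hr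
  | step h ho =>
    obtain rfl := h.eq_of_adj_left hD hC hf hr
    exact ⟨_, ⟨ho, _, _, h⟩, h⟩

/-- The second neighborhood property passes from the extension to `D`: if the extension gives `f`
a new out-neighbor `b`, where `fb` loses to `cd`, then `d` is the only new vertex that `f`
reaches. -/
theorem HasSNP.of_extend [Finite V] (h : D.extend.HasSNP f) : D.HasSNP f := by
  unfold HasSNP at h ⊢
  by_cases hn : ∃ b, D.NewArc f b
  · obtain ⟨b, hb⟩ := hn
    obtain ⟨hob, c, d, hl⟩ := id hb
    have huniq : ∀ b', D.NewArc f b' → b' = b := fun b' hb' =>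
      hC.matched_unique (hb'.matched hD hC) (hb.matched hD hC)
    have hout : D.extend.outNbrs f = insert b (D.outNbrs f) := by
      ext x
      refine ⟨?_, ?_⟩
      · rintro (hx | hx)
        · exact Or.inr hx
        · exact Or.inl (huniq x hx)
      · rintro (rfl | hx)
        · exact Or.inr hb
        · exact Or.inl hx
    have hsec : D.extend.secondOutNbrs f ⊆ insert d (D.secondOutNbrs f) := by
      rintro v ⟨hvf, hfv, u, hfu, huv⟩
      by_cases hr : D.Reach f v
      · exact Or.inr (mem_secondOutNbrs_of_reach hD hr fun e => hfv (Or.inl e))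
      left
      obtain hfu | hfu := hfu
      · obtain huv | huv := huv
        · exact absurd (Or.inr ⟨u, hfu, huv⟩) hr
        · obtain ⟨b', hb', hl'⟩ := huv.1.exists_newArc hD hC hfu hr
          obtain rfl := huniq b' hb'
          exact hl.succ_unique hD hC hl'
      · obtain rfl := huniq u hfu
        obtain huv | huv := huv
        · exact hl.eq_of_adj_right hD hC huv hr
        · exact absurd (hC.matched_unique (huv.matched hD hC)
            (hC.matched_symm (hb.matched hD hC))) hvf
    have hbf : b ∉ D.outNbrs f := hl.1.2.1
    rw [hout, Set.ncard_insert_of_notMem hbf] at h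
    have h1 := Set.ncard_le_ncard hsec (Set.toFinite _)
    have h2 := Set.ncard_insert_le d (D.secondOutNbrs f)
    omega
  · have hout : D.outNbrs f ⊆ D.extend.outNbrs f := fun x hx => Or.inl hx
    have hsec : D.extend.secondOutNbrs f ⊆ D.secondOutNbrs f := by
      rintro v ⟨hvf, hfv, u, hfu, huv⟩
      by_contra hv
      have hr : ¬ D.Reach f v := fun hr =>
        hv (mem_secondOutNbrs_of_reach hD hr fun e => hfv (Or.inl e))
      obtain hfu | hfu := hfu
      · obtain huv | huv := huv
        · exact hr (Or.inr ⟨u, hfu, huv⟩)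
        · obtain ⟨b, hb, -⟩ := huv.1.exists_newArc hD hC hfu hr
          exact hn ⟨b, hb⟩
      · exact hn ⟨u, hfu⟩
    exact (Set.ncard_le_ncard hout (Set.toFinite _)).trans
      (h.trans (Set.ncard_le_ncard hsec (Set.toFinite _)))

theorem IsCombLike.exists_hasSNP [Finite V] [Nonempty V] : ∃ v, D.HasSNP v := by
  obtain ⟨f, hf⟩ := exists_hasSNP_of_convenient (hD.extend hC) fun a b hm => by
    by_contra! h
    obtain ⟨w, w', hl⟩ := exists_loses_of_not_convenient hm h.1 h.2
    exact not_loses_extend hD hC hl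
  exact ⟨f, hf.of_extend hD hC⟩

end

end Digraph

namespace SimpleGraph

variable {W : Type*}

/-! ### Combs are comb-like -/

namespace CombIndex

/-- The set with this name is one of the sets `A_i`, `M_i`. -/
def IsStable : CombIndex → Prop
  | .A _ | .M _ => True
  | .X _ | .Y _ => False

/-- The definition of a comb joins all vertices of the first set to all vertices of the second.
The set `Y₁` appears under its name `X₁`. -/
def IsJoined (l k₀ : ℕ) : CombIndex → CombIndex → Prop
  | .A i, .X j => j ≤ i ∨ j = 1
  | .A _, .Y _ => True
  | .M i, .Y j => (i < j ∧ j ≤ l) ∨ (j = l + 1 ∧ i ≤ k₀)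
  | _, _ => False

/-- The two sets are `M_i` and `Y_i` for some `i`. The set `Y₁` appears under its name `X₁`. -/
def IsMatched : CombIndex → CombIndex → Prop
  | .M i, .X j => i = 1 ∧ j = 1
  | .M i, .Y j => i = j
  | _, _ => False

variable {n l k₀ : ℕ} {p q p' q' r : CombIndex}

theorem IsMatched.isStable_left (h : IsMatched p q) : p.IsStable := by
  cases p <;> cases q <;> simp_all [IsMatched, IsStable]

theorem IsMatched.not_isStable_right (h : IsMatched p q) : ¬ q.IsStable := by
  cases p <;> cases q <;> simp_all [IsMatched, IsStable]

/-- Neighborhoods in the clique are nested but for the matchings, so that an alternating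
four-cycle has to run along two matching edges of the same level. -/
theorem isMatched_of_alternating (hp : p.InRange n l) (hp' : p'.InRange n l)
    (hq : q.InRange n l) (hq' : q'.InRange n l)
    (h : IsJoined l k₀ p q ∨ IsMatched p q) (h' : IsJoined l k₀ p' q' ∨ IsMatched p' q')
    (hn : ¬ IsJoined l k₀ p q') (hn' : ¬ IsJoined l k₀ p' q) :
    IsMatched p q ∧ IsMatched p' q' ∧ IsMatched p q' ∧ IsMatched p' q := by
  cases p <;> cases p' <;> cases q <;> cases q' <;>
    simp only [IsMatched, IsJoined, InRange, or_false, false_or, and_false, false_and,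
      not_true_eq_false, not_false_eq_true] at * <;> omega

theorem isMatched_of_isMatched_left (hr : r.InRange n l) (hq : q.InRange n l)
    (hq' : q'.InRange n l) (h : IsMatched p q) (h' : IsMatched p q')
    (hrq : IsJoined l k₀ r q ∨ IsMatched r q) (hn : ¬ IsJoined l k₀ r q') : IsMatched r q := by
  cases p <;> cases r <;> cases q <;> cases q' <;>
    simp only [IsMatched, IsJoined, InRange, or_false, false_or, not_true_eq_false,
      not_false_eq_true] at * <;> omega

theorem isMatched_of_isMatched_right (hr : r.InRange n l) (hp : p.InRange n l)
    (hp' : p'.InRange n l) (h : IsMatched p q) (h' : IsMatched p' q)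
    (hpr : IsJoined l k₀ p r ∨ IsMatched p r) (hn : ¬ IsJoined l k₀ p' r) : IsMatched p r := by
  cases p <;> cases r <;> cases q <;> cases p' <;>
    simp only [IsMatched, IsJoined, InRange, or_false, false_or, not_true_eq_false,
      not_false_eq_true] at * <;> omega

theorem isJoined_of_isMatched (hp' : p'.InRange n l) (hq' : q'.InRange n l) (h : IsMatched p q)
    (h1 : IsJoined l k₀ p q') (h2 : IsJoined l k₀ p' q) :
    IsJoined l k₀ p' q' ∧ ¬ IsMatched p' q' := by
  cases p <;> cases p' <;> cases q <;> cases q' <;>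
    simp only [IsMatched, IsJoined, InRange, and_true, not_false_eq_true] at *
  all_goals omega

end CombIndex

open CombIndex

variable {G : SimpleGraph W} {n l k₀ : ℕ} {A M X Y : ℕ → Set W}

/-- Adjacency in a comb in terms of the names `c v` of the sets containing the vertices `v`. -/
structure IsCombCode (G : SimpleGraph W) (n l k₀ : ℕ) (c : W → CombIndex) : Prop where
  inRange : ∀ v, (c v).InRange n l
  not_adj : ∀ {u v}, (c u).IsStable → (c v).IsStable → ¬ G.Adj u v
  adj : ∀ {u v}, ¬ (c u).IsStable → ¬ (c v).IsStable → u ≠ v → G.Adj u v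
  adj_of_isJoined : ∀ {u v}, IsJoined l k₀ (c u) (c v) → G.Adj u v
  isJoined_or_isMatched : ∀ {u v}, G.Adj u v → (c u).IsStable → ¬ (c v).IsStable →
    IsJoined l k₀ (c u) (c v) ∨ IsMatched (c u) (c v)
  right_unique : ∀ {u v v'}, IsMatched (c u) (c v) → G.Adj u v → IsMatched (c u) (c v') →
    G.Adj u v' → v = v'
  left_unique : ∀ {u u' v}, IsMatched (c u) (c v) → G.Adj u v → IsMatched (c u') (c v) →
    G.Adj u' v → u = u'

theorem IsCombWith.exists_isCombCode (h : G.IsCombWith n l k₀ A M X Y) :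
    ∃ c, G.IsCombCode n l k₀ c := by
  choose c hc huniq using h.partition
  have hl := h.k₀_pos.trans h.k₀_le
  have hA : ∀ {v i}, i ≤ n → v ∈ A i → c v = .A i := fun hi hv => (huniq _ (.A _) ⟨hi, hv⟩).symm
  have hM : ∀ {v i}, 1 ≤ i → i ≤ l → v ∈ M i → c v = .M i :=
    fun hi hi' hv => (huniq _ (.M _) ⟨⟨hi, hi'⟩, hv⟩).symm
  have hX : ∀ {v i}, 1 ≤ i → i ≤ n + 1 → v ∈ X i → c v = .X i :=
    fun hi hi' hv => (huniq _ (.X _) ⟨⟨hi, hi'⟩, hv⟩).symm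
  have hY : ∀ {v i}, 1 ≤ i → i ≤ l + 2 → v ∈ Y i → (i = 1 ∧ c v = .X 1) ∨ (2 ≤ i ∧ c v = .Y i) := by
    intro v i hi hi' hv
    obtain rfl | hi := hi.eq_or_lt
    · exact Or.inl ⟨rfl, hX le_rfl (by omega) (h.Y_one ▸ hv)⟩
    · exact Or.inr ⟨hi, (huniq _ (.Y i) ⟨⟨hi, hi'⟩, hv⟩).symm⟩
  have hS : ∀ v, (c v).IsStable → v ∈ (⋃ i ∈ Set.Icc 0 n, A i) ∪ ⋃ i ∈ Set.Icc 1 l, M i := by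
    intro v hv
    obtain ⟨h1, h2⟩ := hc v
    generalize c v = p at hv h1 h2
    cases p with
    | A i => exact Or.inl (Set.mem_biUnion (⟨Nat.zero_le _, h1⟩ : i ∈ Set.Icc 0 n) h2)
    | M i => exact Or.inr (Set.mem_biUnion (h1 : i ∈ Set.Icc 1 l) h2)
    | X i => exact hv.elim
    | Y i => exact hv.elim
  have hK : ∀ v, ¬ (c v).IsStable →
      v ∈ (⋃ i ∈ Set.Icc 1 (n + 1), X i) ∪ ⋃ i ∈ Set.Icc 1 (l + 2), Y i := by
    intro v hv
    obtain ⟨h1, h2⟩ := hc v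
    generalize c v = p at hv h1 h2
    cases p with
    | A i => exact absurd trivial hv
    | M i => exact absurd trivial hv
    | X i => exact Or.inl (Set.mem_biUnion (h1 : i ∈ Set.Icc 1 (n + 1)) h2)
    | Y i => exact Or.inr (Set.mem_biUnion (⟨by have := h1.1; omega, h1.2⟩ :
        i ∈ Set.Icc 1 (l + 2)) h2)
  have hmatch : ∀ {u v}, IsMatched (c u) (c v) → ∃ i, 1 ≤ i ∧ i ≤ l ∧ c u = .M i ∧ u ∈ M i ∧
      v ∈ Y i := by
    intro u v huv
    obtain ⟨h1, h2⟩ := hc u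
    obtain ⟨h3, h4⟩ := hc v
    generalize c u = p, c v = q at *
    cases p <;> cases q <;> simp only [IsMatched, InRange, toSet] at *
    · obtain ⟨rfl, rfl⟩ := huv
      exact ⟨1, le_rfl, hl, rfl, h2, h.Y_one ▸ h4⟩
    · subst huv
      exact ⟨_, h1.1, h1.2, rfl, h2, h4⟩
  refine ⟨c, fun v => (hc v).1, ?_, ?_, ?_, ?_, ?_, ?_⟩
  · exact fun hu hv e => h.stable (hS _ hu) (hS _ hv) e.ne e
  · exact fun hu hv e => h.clique (hK _ hu) (hK _ hv) e
  · intro u v huv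
    obtain ⟨h1, h2⟩ := hc u
    obtain ⟨h3, h4⟩ := hc v
    have hAY : ∀ i j, i ≤ n → 1 ≤ j → j ≤ l + 2 → u ∈ A i → v ∈ Y j → G.Adj u v :=
      fun i j hi hj hj' hu hv => h.complete_A_Y.2 u
        (Set.mem_biUnion (⟨Nat.zero_le _, hi⟩ : i ∈ Set.Icc 0 n) hu) v
        (Set.mem_biUnion (⟨hj, hj'⟩ : j ∈ Set.Icc 1 (l + 2)) hv)
    generalize c u = p, c v = q at *
    cases p <;> cases q <;> simp only [IsJoined, InRange, toSet] at *
    · obtain huv | rfl := huv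
      · exact (h.complete_A_X _ _ h3.1 huv h1).2 u h2 v h4
      · exact hAY _ 1 h1 le_rfl (by omega) h2 (h.Y_one ▸ h4)
    · exact hAY _ _ h1 (by omega) h3.2 h2 h4
    · obtain ⟨h5, h6⟩ | ⟨rfl, h6⟩ := huv
      · exact (h.complete_M_Y _ _ h1.1 h5 h6).2 u h2 v h4
      · exact (h.complete_M_Y_last _ h1.1 h6).2 u h2 v h4
  · intro u v huv hu hv
    obtain ⟨i, j, hj, hji, hi, hu, hv⟩ | ⟨i, j, hi, hj, hj', hu, hv⟩ | ⟨i, hi, hi', hu, hv⟩ |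
      ⟨i, j, hi, hij, hj, hu, hv⟩ | ⟨i, hi, hi', hu, hv⟩ := h.only_edges u v huv (hS u hu) (hK v hv)
    · rw [hA hi hu, hX hj (by omega) hv]
      exact Or.inl (Or.inl hji)
    · rw [hA hi hu]
      obtain ⟨-, e⟩ | ⟨-, e⟩ := hY hj hj' hv <;> rw [e]
      · exact Or.inl (Or.inr rfl)
      · exact Or.inl trivial
    · rw [hM hi hi' hu]
      obtain ⟨rfl, e⟩ | ⟨-, e⟩ := hY hi (by omega) hv <;> rw [e]
      · exact Or.inr ⟨rfl, rfl⟩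
      · exact Or.inr rfl
    · rw [hM hi (by omega) hu]
      obtain ⟨rfl, e⟩ | ⟨-, e⟩ := hY (by omega) (by omega) hv
      · omega
      · rw [e]
        exact Or.inl (Or.inl ⟨hij, hj⟩)
    · have := h.k₀_le
      rw [hM hi (by omega) hu]
      obtain ⟨e', e⟩ | ⟨-, e⟩ := hY (by omega) (by omega) hv
      · omega
      · rw [e]
        exact Or.inl (Or.inr ⟨rfl, hi'⟩)
  · intro u v v' huv e huv' e'
    obtain ⟨i, hi, hi', hci, hu, hv⟩ := hmatch huv
    obtain ⟨j, -, -, hcj, -, hv'⟩ := hmatch huv'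
    obtain rfl : i = j := by simpa [hci] using hcj
    exact ((h.perfect_M_Y i hi hi' ⟨u, hu⟩).2.1 u hu).unique ⟨hv, e⟩ ⟨hv', e'⟩
  · intro u u' v huv e huv' e'
    obtain ⟨i, hi, hi', hci, hu, hv⟩ := hmatch huv
    obtain ⟨j, hj, hj', hcj, hu', hv'⟩ := hmatch huv'
    obtain rfl : i = j := by
      obtain ⟨h1, h2⟩ | ⟨h1, h2⟩ := hY hi (by omega) hv <;>
        obtain ⟨h3, h4⟩ | ⟨h3, h4⟩ := hY hj (by omega) hv' <;> simp_all
    exact ((h.perfect_M_Y i hi hi' ⟨u, hu⟩).2.2 v hv).unique ⟨hu, e⟩ ⟨hu', e'⟩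

theorem IsCombCode.alternating {c : W → CombIndex} (h : G.IsCombCode n l k₀ c) {a b d e : W}
    (hab : G.Adj a b) (hde : G.Adj d e) (hne : a ≠ d) (had : ¬ G.Adj a d) (hne' : b ≠ e)
    (hbe : ¬ G.Adj b e) :
    (IsMatched (c a) (c b) ∧ IsMatched (c e) (c d) ∧ IsMatched (c a) (c d) ∧
      IsMatched (c e) (c b)) ∨
    (IsMatched (c b) (c a) ∧ IsMatched (c d) (c e) ∧ IsMatched (c b) (c e) ∧
      IsMatched (c d) (c a)) := by
  have h1 := fun hu hv => h.not_adj hu hv hab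
  have h2 := fun hu hv => h.not_adj hu hv hde
  have h3 := fun hu hv => had (h.adj hu hv hne)
  have h4 := fun hu hv => hbe (h.adj hu hv hne')
  by_cases ha : (c a).IsStable
  · have hb : ¬ (c b).IsStable := h1 ha
    have he : (c e).IsStable := by_contra (h4 hb)
    have hd : ¬ (c d).IsStable := fun hd => h2 hd he
    exact Or.inl (isMatched_of_alternating (h.inRange a) (h.inRange e) (h.inRange b) (h.inRange d)
      (h.isJoined_or_isMatched hab ha hb) (h.isJoined_or_isMatched hde.symm he hd)
      (fun e => had (h.adj_of_isJoined e)) fun e => hbe (h.adj_of_isJoined e).symm)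
  · have hd : (c d).IsStable := by_contra (h3 ha)
    have he : ¬ (c e).IsStable := h2 hd
    have hb : (c b).IsStable := by_contra fun hb => h4 hb he
    exact Or.inr (isMatched_of_alternating (h.inRange b) (h.inRange d) (h.inRange a) (h.inRange e)
      (h.isJoined_or_isMatched hab.symm hb ha) (h.isJoined_or_isMatched hde hd he)
      (fun e => hbe (h.adj_of_isJoined e)) fun e => had (h.adj_of_isJoined e).symm)

theorem IsCombCode.isCombLike {c : W → CombIndex} (h : G.IsCombCode n l k₀ c) :
    Digraph.IsCombLike G.Adj {v | (c v).IsStable}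
      fun u v => G.Adj u v ∧ (IsMatched (c u) (c v) ∨ IsMatched (c v) (c u)) where
  stable a ha b hb := h.not_adj ha hb
  matched_symm h := ⟨h.1.symm, h.2.symm⟩
  matched_unique := by
    rintro a b b' ⟨h1, h2⟩ ⟨h3, h4⟩
    obtain h2 | h2 := h2 <;> obtain h4 | h4 := h4
    · exact h.right_unique h2 h1 h4 h3
    · exact absurd h2.isStable_left h4.not_isStable_right
    · exact absurd h4.isStable_left h2.not_isStable_right
    · exact h.left_unique h2 h1.symm h4 h3.symm
  mem_iff_of_matched := by
    rintro a b ⟨-, h | h⟩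
    · exact iff_of_true h.isStable_left h.not_isStable_right
    · exact iff_of_false h.not_isStable_right fun e => e h.isStable_left
  matched_of_alternating := by
    intro a b d e h1 h2 h3 h4 h5 h6
    exact ⟨h1, (h.alternating h1 h2 h3 h4 h5 h6).imp And.left And.left⟩
  mem_iff_of_alternating := by
    intro a b d e h1 h2 h3 h4 h5 h6
    obtain ⟨h7, h8, -⟩ | ⟨h7, h8, -⟩ := h.alternating h1 h2 h3 h4 h5 h6
    · exact iff_of_true h7.isStable_left h8.isStable_left
    · exact iff_of_false h7.not_isStable_right h8.not_isStable_right
  eq_of_alternating := by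
    intro a b d e f h1 h2 h3 h4 h5 h6 hfb hfd hnfd
    obtain ⟨h7, h8, h9, h10⟩ | ⟨h7, h8, h9, h10⟩ := h.alternating h1 h2 h3 h4 h5 h6
    · have hf : (c f).IsStable := by_contra fun hf => hnfd (h.adj hf h8.not_isStable_right hfd)
      exact h.left_unique (isMatched_of_isMatched_left (h.inRange f) (h.inRange b) (h.inRange d)
        h7 h9 (h.isJoined_or_isMatched hfb hf h7.not_isStable_right)
        fun e => hnfd (h.adj_of_isJoined e)) hfb h7 h1
    · have hf : ¬ (c f).IsStable := fun hf => h.not_adj hf h7.isStable_left hfb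
      exact h.right_unique (isMatched_of_isMatched_right (h.inRange f) (h.inRange b) (h.inRange d)
        h7 h10 (h.isJoined_or_isMatched hfb.symm h7.isStable_left hf)
        fun e => hnfd (h.adj_of_isJoined e).symm) hfb.symm h7 h1.symm
  of_matched := by
    rintro w a w' b ⟨hwa, hm⟩ hww' hab hne hne'
    have key : ∀ {w a w' b}, G.Adj w a → IsMatched (c w) (c a) → G.Adj w w' → G.Adj a b →
        w' ≠ a → b ≠ w → (c b).IsStable →
          G.Adj b w' ∧ ¬ IsMatched (c b) (c w') ∧ ¬ IsMatched (c w') (c b) := by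
      intro w a w' b hwa hm hww' hab hne hne' hb
      have hw' : ¬ (c w').IsStable := fun hw' => h.not_adj hm.isStable_left hw' hww'
      have h1 : IsJoined l k₀ (c w) (c w') :=
        (h.isJoined_or_isMatched hww' hm.isStable_left hw').resolve_right fun e =>
          hne (h.right_unique e hww' hm hwa)
      have h2 : IsJoined l k₀ (c b) (c a) :=
        (h.isJoined_or_isMatched hab.symm hb hm.not_isStable_right).resolve_right fun e =>
          hne' (h.left_unique e hab.symm hm hwa)
      obtain ⟨h3, h4⟩ := isJoined_of_isMatched (h.inRange b) (h.inRange w') hm h1 h2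
      exact ⟨h.adj_of_isJoined h3, h4, fun e => hw' e.isStable_left⟩
    have clique : ∀ {x y}, ¬ (c x).IsStable → ¬ (c y).IsStable → (x = y ∨ G.Adj x y) ∧
        ¬ (G.Adj x y ∧ (IsMatched (c x) (c y) ∨ IsMatched (c y) (c x))) := by
      intro x y hx hy
      refine ⟨?_, ?_⟩
      · by_cases e : x = y
        · exact Or.inl e
        · exact Or.inr (h.adj hx hy e)
      · rintro ⟨-, e | e⟩
        · exact hx e.isStable_left
        · exact hy e.isStable_left
    obtain hm | hm := hm
    · by_cases hb : (c b).IsStable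
      · obtain ⟨h1, h2, h3⟩ := key hwa hm hww' hab hne hne' hb
        exact ⟨Or.inr h1.symm, fun e => e.2.elim h3 h2⟩
      · exact clique (fun hw' => h.not_adj hm.isStable_left hw' hww') hb
    · by_cases hw' : (c w').IsStable
      · obtain ⟨h1, h2, h3⟩ := key hwa.symm hm hab hww' hne' hne hw'
        exact ⟨Or.inr h1, fun e => e.2.elim h2 h3⟩
      · exact clique hw' fun hb => h.not_adj hm.isStable_left hb hab

end SimpleGraph

namespace Digraph

variable {V : Type*}

/-- Whole vertices may be put into the stable part. -/
theorem IsCombLike.of_subtype {r : V → V → Prop} (hr : ∀ a b, r a b → r b a) {p : V → Prop}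
    (hp : ∀ a b, r a b → p a) {S : Set (Subtype p)} {Mt : Subtype p → Subtype p → Prop}
    (h : IsCombLike (fun a b : Subtype p => r a b) S Mt) :
    IsCombLike r {v | ∀ hv : p v, ⟨v, hv⟩ ∈ S}
      fun a b => ∃ (ha : p a) (hb : p b), Mt ⟨a, ha⟩ ⟨b, hb⟩ where
  stable a ha b hb hab := by
    have h1 := hp _ _ hab
    have h2 := hp _ _ (hr _ _ hab)
    exact h.stable ⟨a, h1⟩ (ha h1) ⟨b, h2⟩ (hb h2) hab
  matched_symm := fun ⟨ha, hb, e⟩ => ⟨hb, ha, h.matched_symm e⟩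
  matched_unique := fun ⟨_, _, e⟩ ⟨_, _, e'⟩ => congrArg Subtype.val (h.matched_unique e e')
  mem_iff_of_matched := by
    rintro a b ⟨ha, hb, e⟩
    simpa [ha, hb] using h.mem_iff_of_matched e
  matched_of_alternating := by
    intro a b c d hab hcd hac hac' hbd hbd'
    have ha := hp _ _ hab
    have hb := hp _ _ (hr _ _ hab)
    have hc := hp _ _ hcd
    have hd := hp _ _ (hr _ _ hcd)
    exact ⟨ha, hb, h.matched_of_alternating (c := ⟨c, hc⟩) (d := ⟨d, hd⟩) hab hcd
      (by simpa using hac) hac' (by simpa using hbd) hbd'⟩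
  mem_iff_of_alternating := by
    intro a b c d hab hcd hac hac' hbd hbd'
    have ha := hp _ _ hab
    have hb := hp _ _ (hr _ _ hab)
    have hc := hp _ _ hcd
    have hd := hp _ _ (hr _ _ hcd)
    simpa [ha, hd] using h.mem_iff_of_alternating (a := ⟨a, ha⟩) (b := ⟨b, hb⟩) (c := ⟨c, hc⟩)
      (d := ⟨d, hd⟩) hab hcd (by simpa using hac) hac' (by simpa using hbd) hbd'
  eq_of_alternating := by
    intro a b c d f hab hcd hac hac' hbd hbd' hfb hfc hfc'
    have ha := hp _ _ hab
    have hb := hp _ _ (hr _ _ hab)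
    have hc := hp _ _ hcd
    have hd := hp _ _ (hr _ _ hcd)
    have hf := hp _ _ hfb
    exact congrArg Subtype.val (h.eq_of_alternating (a := ⟨a, ha⟩) (b := ⟨b, hb⟩) (c := ⟨c, hc⟩)
      (d := ⟨d, hd⟩) (f := ⟨f, hf⟩) hab hcd (by simpa using hac) hac' (by simpa using hbd) hbd'
      hfb (by simpa using hfc) hfc')
  of_matched := by
    rintro w a w' b ⟨hw, ha, e⟩ hww' hab hne hne'
    have hw' := hp _ _ (hr _ _ hww')
    have hb := hp _ _ (hr _ _ hab)
    obtain ⟨h1, h2⟩ := h.of_matched (w' := ⟨w', hw'⟩) (b := ⟨b, hb⟩) e hww' hab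
      (by simpa using hne) (by simpa using hne')
    exact ⟨h1.imp_left (congrArg Subtype.val), fun ⟨_, _, e⟩ => h2 e⟩

end Digraph

theorem mainTheorem1 {V : Type*} [Finite V] [Nonempty V] (D : Digraph V) (hD : D.IsOriented)
    (hcomb : D.missingGraph.IsComb) : ∃ v : V, D.HasSNP v := by
  obtain ⟨n, l, k₀, A, M, X, Y, h⟩ := hcomb
  obtain ⟨c, hc⟩ := h.exists_isCombCode
  exact (Digraph.IsCombLike.of_subtype (fun _ _ e => e.symm)
    (fun _ b e hw => hw b e) hc.isCombLike).exists_hasSNP hD
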